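/- Let $X,Y$ be complex Banach spaces with $X$ reflexive, and let $T\colon X\to X$ be a Ritt operator, i.e. a bounded operator for which there exist constants $c_0,c_1\ge 0$ with $$\|T^k\|\le c_0\quad(k\ge 0),\qquad k\,\|T^k-T^{k-1}\|\le c_1\quad(k\ge 1).$$ Assume that $T$ satisfies the square function estimate: there exists $\kappa\ge 0$ such that $$\sum_{k=1}^{\infty}k\,\|T^kx-T^{k-1}x\|^2\le\kappa^2\|x\|^2,\qquad x\in X.$$ Let $\alpha>-1$ and $\beta\in(-1,3)$ be real numbers such that $m=\frac{\alpha+\beta}{2}$ is a nonnegative integer, and let $C\colon X\to Y$ be a bounded operator. Then $C$ is $\alpha$-admissible for $T$, i.e. there exists $M\ge 0$ such that $$\sum_{k=0}^{\infty}(k+1)^{\alpha}\,\|CT^kx\|^2\le M^2\|x\|^2,\qquad x\in X,$$ if and only if there exists $K\ge 0$ such that $$(1-|\omega|^2)^{\frac{1+\beta}{2}}\,\|C(I-\omega T)^{-(m+1)}\|\le K\qquad\text{for all }\omega\in\mathbb{C}\text{ with }|\omega|<1.$$ -/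

import Mathlib

namespace RittAdmissibility

/-- A normed space is reflexive when the canonical map into its (topological) bidual is onto. -/
def IsReflexiveSpace (X : Type*) [NormedAddCommGroup X] [NormedSpace ℂ X] : Prop :=
  Function.Surjective (NormedSpace.inclusionInDoubleDual ℂ X)

/-- `T` is power bounded: its powers `T ^ k`, `k ≥ 0`, are uniformly bounded in norm. -/
def IsPowerBounded {X : Type*} [NormedAddCommGroup X] [NormedSpace ℂ X] (T : X →L[ℂ] X) : Prop :=
  ∃ c₀ : ℝ, 0 ≤ c₀ ∧ ∀ k : ℕ, ‖T ^ k‖ ≤ c₀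

/-- `T` is a Ritt operator: power bounded with `k ‖T ^ k - T ^ (k - 1)‖` bounded over `k ≥ 1`. -/
def IsRitt {X : Type*} [NormedAddCommGroup X] [NormedSpace ℂ X] (T : X →L[ℂ] X) : Prop :=
  IsPowerBounded T ∧
    ∃ c₁ : ℝ, 0 ≤ c₁ ∧ ∀ k : ℕ, 1 ≤ k → (k : ℝ) * ‖T ^ k - T ^ (k - 1)‖ ≤ c₁

/-- The square function estimate
`∑_{k ≥ 1} k ‖T ^ k x - T ^ (k - 1) x‖² ≤ κ² ‖x‖²` for all `x`;
the sum is reindexed to start at `k = 0`. -/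
def SquareFunctionEstimate {X : Type*} [NormedAddCommGroup X] [NormedSpace ℂ X]
    (T : X →L[ℂ] X) : Prop :=
  ∃ κ : ℝ, 0 ≤ κ ∧ ∀ x : X,
    Summable (fun k : ℕ => ((k : ℝ) + 1) * ‖(T ^ (k + 1)) x - (T ^ k) x‖ ^ 2) ∧
    ∑' k : ℕ, ((k : ℝ) + 1) * ‖(T ^ (k + 1)) x - (T ^ k) x‖ ^ 2 ≤ κ ^ 2 * ‖x‖ ^ 2

/-- `C` is `α`-admissible for `T`:
`∑_{k ≥ 0} (k + 1) ^ α ‖C (T ^ k x)‖² ≤ M² ‖x‖²` for all `x`, with convergent sums. -/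
def IsAdmissible {X Y : Type*} [NormedAddCommGroup X] [NormedSpace ℂ X]
    [NormedAddCommGroup Y] [NormedSpace ℂ Y] (α : ℝ) (T : X →L[ℂ] X) (C : X →L[ℂ] Y) : Prop :=
  ∃ M : ℝ, 0 ≤ M ∧ ∀ x : X,
    Summable (fun k : ℕ => ((k : ℝ) + 1) ^ α * ‖C ((T ^ k) x)‖ ^ 2) ∧
    ∑' k : ℕ, ((k : ℝ) + 1) ^ α * ‖C ((T ^ k) x)‖ ^ 2 ≤ M ^ 2 * ‖x‖ ^ 2

/-- The resolvent estimate
`(1 - |ω|²) ^ ((1 + β) / 2) ‖C (I - ω T) ^ (-(m + 1))‖ ≤ K` for all `ω` in the open unit disc.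
For power bounded `T` the operator `I - ω T` is invertible there (see `isUnit_one_sub_smul`),
so `Ring.inverse` is its genuine inverse. -/
def ResolventEstimate {X Y : Type*} [NormedAddCommGroup X] [NormedSpace ℂ X]
    [NormedAddCommGroup Y] [NormedSpace ℂ Y] (β : ℝ) (m : ℕ) (T : X →L[ℂ] X) (C : X →L[ℂ] Y) :
    Prop :=
  ∃ K : ℝ, 0 ≤ K ∧ ∀ ω : ℂ, ‖ω‖ < 1 →
    (1 - ‖ω‖ ^ 2) ^ ((1 + β) / 2) * ‖C ∘L (Ring.inverse (1 - ω • T) ^ (m + 1))‖ ≤ K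

theorem isUnit_one_sub_smul {X : Type*} [NormedAddCommGroup X] [NormedSpace ℂ X]
    [CompleteSpace X] {T : X →L[ℂ] X} (hT : IsPowerBounded T) {ω : ℂ} (hω : ‖ω‖ < 1) :
    IsUnit (1 - ω • T) := by
  obtain ⟨c, -, hc⟩ := hT
  have hs : Summable (fun k : ℕ => (ω • T) ^ k) := by
    refine Summable.of_norm_bounded (g := fun k : ℕ => ‖ω‖ ^ k * c)
      ((summable_geometric_of_lt_one (norm_nonneg _) hω).mul_right c) fun k => ?_
    rw [smul_pow, norm_smul, norm_pow]
    exact mul_le_mul_of_nonneg_left (hc k) (by positivity)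
  exact ⟨⟨1 - ω • T, ∑' k : ℕ, (ω • T) ^ k, hs.one_sub_mul_tsum_pow, hs.tsum_pow_mul_one_sub⟩, rfl⟩

end RittAdmissibility

/-!
Put `δ = (1 + α) / 2 > 0`, so that `α = 2 δ - 1` and `(1 + β) / 2 = m + 1 - δ`.

*Admissibility gives the resolvent estimate.* The operator `(I - ω T)^{-(m+1)}` is the sum of
`choose (k + m) m • (ω T) ^ k` (`tendsto_sum_choose_smul_pow`). The coefficient is at most
`(k + 1) ^ m`, and Cauchy–Schwarz with weight `(k + 1) ^ α` leaves
`∑ (k + 1) ^ β |ω| ^ (2 k) ≤ c (1 - |ω|²) ^ (-(1 + β))` (`exists_sum_rpow_mul_pow_le`).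

*The resolvent estimate gives admissibility.* With `r = n / (n + 1)`, the Ritt condition bounds
`T ^ n (I - r T) = (1 - r) T ^ n + r T ^ n (I - T)` by a multiple of `1 / (n + 1)`. Inserting
`(I - r T)^{-(m+1)} (I - r T) ^ (m+1)` after `C` therefore yields
`‖C T ^ {(m+1) n}‖ ≤ D (n + 1) ^ (-δ)` (`exists_norm_comp_pow_mul_le`). In particular these
operators tend to zero, so with `q = m + 2` the vector `C T ^ {q l} x` is the sum over `n ≥ l` of
`C T ^ {(m+1) n} (I - T ^ q) T ^ n x`, whose norm is at most a multiple of
`(n + 1) ^ (-δ) ‖T ^ n (I - T) x‖`. A discrete Hardy inequality (`exists_hardy_le`) converts this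
into a bound of `∑ (l + 1) ^ α ‖C T ^ {q l} x‖²` by the square function of `x`. The remaining powers
of `T` are reached by applying this to `T ^ s x`, `s < q`.
-/

namespace RittAdmissibility

open Filter Topology

/-! ### Power sums and a discrete Hardy inequality -/

theorem exists_sum_rpow_sub_one_le {δ : ℝ} (hδ : 0 < δ) :
    ∃ c : ℝ, 0 ≤ c ∧ ∀ n : ℕ,
      ∑ k ∈ Finset.range n, ((k : ℝ) + 1) ^ (δ - 1) ≤ c * (n : ℝ) ^ δ := by
  rcases le_total 1 δ with h1 | h1
  · refine ⟨1, zero_le_one, fun n => ?_⟩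
    rcases Nat.eq_zero_or_pos n with rfl | hn
    · simp [Real.zero_rpow hδ.ne']
    have hn' : (0 : ℝ) < n := by exact_mod_cast hn
    calc ∑ k ∈ Finset.range n, ((k : ℝ) + 1) ^ (δ - 1)
        ≤ ∑ k ∈ Finset.range n, (n : ℝ) ^ (δ - 1) := by
          refine Finset.sum_le_sum fun k hk => ?_
          have : (k : ℝ) + 1 ≤ n := by exact_mod_cast Finset.mem_range.1 hk
          exact Real.rpow_le_rpow (by positivity) this (by linarith)
      _ = 1 * (n : ℝ) ^ δ := by
          rw [Finset.sum_const, Finset.card_range, nsmul_eq_mul, Real.rpow_sub_one hn'.ne']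
          field_simp
  · refine ⟨1 / δ, by positivity, fun n => ?_⟩
    induction n with
    | zero => simp [Real.zero_rpow hδ.ne']
    | succ n ih =>
      rw [Finset.sum_range_succ]
      have hp : (0 : ℝ) < (n : ℝ) + 1 := by positivity
      -- Bernoulli: `(n / (n + 1)) ^ δ ≤ 1 - δ / (n + 1)`.
      have hb := rpow_one_add_le_one_add_mul_self (s := -(1 / ((n : ℝ) + 1)))
        (by rw [neg_le_neg_iff, div_le_one hp]; linarith [Nat.cast_nonneg (α := ℝ) n])
        hδ.le h1
      have he : 1 + -(1 / ((n : ℝ) + 1)) = n / (n + 1) := by field_simp; ring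
      rw [he, Real.div_rpow (by positivity) hp.le, div_le_iff₀ (by positivity)] at hb
      have hs : ((n : ℝ) + 1) ^ (δ - 1) = ((n : ℝ) + 1) ^ δ / (n + 1) :=
        Real.rpow_sub_one hp.ne' δ
      have h2 : ((n : ℝ) + 1) ^ (δ - 1) ≤ 1 / δ * (((n : ℝ) + 1) ^ δ - (n : ℝ) ^ δ) := by
        rw [hs, one_div_mul_eq_div, le_div_iff₀ hδ]
        have : (1 + δ * -(1 / ((n : ℝ) + 1))) * ((n : ℝ) + 1) ^ δ
            = ((n : ℝ) + 1) ^ δ - ((n : ℝ) + 1) ^ δ / (n + 1) * δ := by ring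
        linarith
      push_cast
      linarith

theorem exists_sum_Ico_rpow_neg_le {δ : ℝ} (hδ : 0 < δ) :
    ∃ c : ℝ, 0 ≤ c ∧ ∀ k N : ℕ, k ≤ N →
      ∑ n ∈ Finset.Ico k N, ((n : ℝ) + 1) ^ (-(1 + δ)) ≤ c * ((k : ℝ) + 1) ^ (-δ) := by
  refine ⟨2 ^ (1 + δ) / δ, by positivity, fun k N hkN => ?_⟩
  suffices h : ∑ n ∈ Finset.Ico k N, ((n : ℝ) + 1) ^ (-(1 + δ)) ≤
      2 ^ (1 + δ) / δ * (((k : ℝ) + 1) ^ (-δ) - ((N : ℝ) + 1) ^ (-δ)) by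
    refine h.trans ?_
    have : 0 ≤ ((N : ℝ) + 1) ^ (-δ) := by positivity
    gcongr
    linarith
  induction N, hkN using Nat.le_induction with
  | base => simp
  | succ n hn ih =>
    rw [Finset.sum_Ico_succ_top hn]
    have hp : (0 : ℝ) < (n : ℝ) + 1 := by positivity
    have hp2 : (0 : ℝ) < (n : ℝ) + 2 := by positivity
    -- `((n + 2) / (n + 1)) ^ δ ≥ 1 + δ log ((n + 2) / (n + 1)) ≥ 1 + δ / (n + 2)`, which makes the
    -- summand a multiple of `(n + 1) ^ (-δ) - (n + 2) ^ (-δ)`.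
    have hlog := Real.one_sub_inv_le_log_of_pos (x := ((n : ℝ) + 2) / (n + 1)) (by positivity)
    have hexp := Real.add_one_le_exp (δ * Real.log (((n : ℝ) + 2) / (n + 1)))
    rw [mul_comm δ, ← Real.rpow_def_of_pos (by positivity),
      Real.div_rpow hp2.le hp.le] at hexp
    have he : 1 - (((n : ℝ) + 2) / (n + 1))⁻¹ = 1 / (n + 2) := by field_simp; ring
    rw [he] at hlog
    have h1 : ((n : ℝ) + 2) ^ (-δ) * (1 + δ / (n + 2)) ≤ ((n : ℝ) + 1) ^ (-δ) := by
      have h3 : 1 + δ / ((n : ℝ) + 2) ≤ ((n : ℝ) + 2) ^ δ / ((n : ℝ) + 1) ^ δ := by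
        have := mul_le_mul_of_nonneg_left hlog hδ.le
        have e : δ * (1 / ((n : ℝ) + 2)) = δ / (n + 2) := by ring
        linarith
      calc ((n : ℝ) + 2) ^ (-δ) * (1 + δ / (n + 2))
          ≤ ((n : ℝ) + 2) ^ (-δ) * (((n : ℝ) + 2) ^ δ / ((n : ℝ) + 1) ^ δ) := by gcongr
        _ = ((n : ℝ) + 1) ^ (-δ) := by
          rw [Real.rpow_neg hp2.le, Real.rpow_neg hp.le]
          field_simp
    have h2 : ((n : ℝ) + 1) ^ (-(1 + δ)) ≤ 2 ^ (1 + δ) * ((n : ℝ) + 2) ^ (-(1 + δ)) := by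
      rw [Real.rpow_neg hp.le, Real.rpow_neg hp2.le, ← div_eq_mul_inv, inv_eq_one_div,
        div_le_div_iff₀ (by positivity) (by positivity), one_mul,
        ← Real.mul_rpow (by norm_num) hp.le]
      exact Real.rpow_le_rpow hp2.le (by linarith [Nat.cast_nonneg (α := ℝ) n]) (by linarith)
    have h3 : ((n : ℝ) + 2) ^ (-(1 + δ)) = ((n : ℝ) + 2) ^ (-δ) / (n + 2) := by
      rw [← Real.rpow_sub_one hp2.ne']; congr 1; ring
    have h4 : ((n : ℝ) + 1) ^ (-(1 + δ)) ≤
        2 ^ (1 + δ) / δ * (((n : ℝ) + 1) ^ (-δ) - ((n : ℝ) + 2) ^ (-δ)) := by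
      refine h2.trans ?_
      rw [div_mul_eq_mul_div, mul_div_assoc]
      gcongr
      rw [le_div_iff₀ hδ, h3]
      have : ((n : ℝ) + 2) ^ (-δ) * (1 + δ / (n + 2))
        = ((n : ℝ) + 2) ^ (-δ) + ((n : ℝ) + 2) ^ (-δ) / (n + 2) * δ := by ring
      linarith
    push_cast
    have e : (n : ℝ) + 1 + 1 = n + 2 := by ring
    rw [e]
    calc _ ≤ _ := add_le_add ih h4
      _ = _ := by ring

/-- The dual discrete Hardy inequality with power weights: the kernel
`(k + 1) ^ (δ - 1/2) (n + 1) ^ (-δ - 1/2)`, `n ≥ k`, is bounded on `ℓ²` for `δ > 0`. Both sums are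
truncated at `N`, with a constant independent of `N`. -/
theorem exists_hardy_le {δ : ℝ} (hδ : 0 < δ) :
    ∃ c : ℝ, 0 ≤ c ∧ ∀ (y : ℕ → ℝ) (N : ℕ),
      ∑ k ∈ Finset.range N, ((k : ℝ) + 1) ^ (2 * δ - 1) *
          (∑ n ∈ Finset.Ico k N, ((n : ℝ) + 1) ^ (-δ) * y n) ^ 2 ≤
        c * ∑ n ∈ Finset.range N, ((n : ℝ) + 1) * y n ^ 2 := by
  obtain ⟨c₁, hc₁, h₁⟩ := exists_sum_rpow_sub_one_le hδ
  obtain ⟨c₂, hc₂, h₂⟩ := exists_sum_Ico_rpow_neg_le hδ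
  refine ⟨c₂ * c₁, by positivity, fun y N => ?_⟩
  have hp : ∀ n : ℕ, (0 : ℝ) < (n : ℝ) + 1 := fun n => by positivity
  calc ∑ k ∈ Finset.range N, ((k : ℝ) + 1) ^ (2 * δ - 1) *
          (∑ n ∈ Finset.Ico k N, ((n : ℝ) + 1) ^ (-δ) * y n) ^ 2
      ≤ ∑ k ∈ Finset.range N, c₂ * (((k : ℝ) + 1) ^ (δ - 1) *
          ∑ n ∈ Finset.Ico k N, ((n : ℝ) + 1) ^ (1 - δ) * y n ^ 2) := by
        refine Finset.sum_le_sum fun k hk => ?_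
        -- Schur test: the weight is split so that both resulting power sums converge.
        have hcs := Finset.sum_sq_le_sum_mul_sum_of_sq_le_mul (Finset.Ico k N)
          (r := fun n => ((n : ℝ) + 1) ^ (-δ) * y n)
          (f := fun n => ((n : ℝ) + 1) ^ (-(1 + δ)))
          (g := fun n => ((n : ℝ) + 1) ^ (1 - δ) * y n ^ 2)
          (fun n _ => by positivity) (fun n _ => by positivity)
          (fun n _ => le_of_eq <| by
            rw [← mul_assoc, ← Real.rpow_add (hp n), mul_pow, ← Real.rpow_mul_natCast (hp n).le]
            congr 2; push_cast; ring)
        have hS : 0 ≤ ∑ n ∈ Finset.Ico k N, ((n : ℝ) + 1) ^ (1 - δ) * y n ^ 2 :=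
          Finset.sum_nonneg fun n _ => by positivity
        calc _ ≤ ((k : ℝ) + 1) ^ (2 * δ - 1) * ((c₂ * ((k : ℝ) + 1) ^ (-δ)) *
              ∑ n ∈ Finset.Ico k N, ((n : ℝ) + 1) ^ (1 - δ) * y n ^ 2) := by
              gcongr
              exact hcs.trans (mul_le_mul_of_nonneg_right
                (h₂ k N (Finset.mem_range.1 hk).le) hS)
          _ = c₂ * ((((k : ℝ) + 1) ^ (2 * δ - 1) * ((k : ℝ) + 1) ^ (-δ)) *
              ∑ n ∈ Finset.Ico k N, ((n : ℝ) + 1) ^ (1 - δ) * y n ^ 2) := by ring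
          _ = _ := by
              rw [← Real.rpow_add (hp k)]; congr 3; ring
    _ = c₂ * ∑ n ∈ Finset.range N, ∑ k ∈ Finset.range (n + 1), ((k : ℝ) + 1) ^ (δ - 1) *
          (((n : ℝ) + 1) ^ (1 - δ) * y n ^ 2) := by
        rw [← Finset.mul_sum]
        simp_rw [Finset.mul_sum (Finset.Ico _ _)]
        congr 1
        refine Finset.sum_comm' fun k n => ?_
        simp only [Finset.mem_range, Finset.mem_Ico]
        omega
    _ ≤ c₂ * ∑ n ∈ Finset.range N, c₁ * (((n : ℝ) + 1) * y n ^ 2) := by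
        gcongr with n hn
        rw [← Finset.sum_mul]
        have h := h₁ (n + 1)
        push_cast at h
        calc _ ≤ (c₁ * ((n : ℝ) + 1) ^ δ) * (((n : ℝ) + 1) ^ (1 - δ) * y n ^ 2) := by gcongr
          _ = c₁ * ((((n : ℝ) + 1) ^ δ * ((n : ℝ) + 1) ^ (1 - δ)) * y n ^ 2) := by ring
          _ = _ := by rw [← Real.rpow_add (hp n)]; simp
    _ = _ := by rw [← Finset.mul_sum]; ring

/-! ### Weighted geometric sums -/

/-- The sum is compared with `L = 1 / (1 - r)`: for `k + 1 ≤ L` the factor `r ^ k` is dropped, and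
for larger `k` the weight `(k + 1) ^ β` is at most `L ^ (β - N) (k + 1) ^ N` with an integer
`N ≥ β`, which leaves a derivative of the geometric series. -/
theorem exists_sum_rpow_mul_pow_le {β : ℝ} (hβ : -1 < β) :
    ∃ c : ℝ, 0 ≤ c ∧ ∀ r : ℝ, 0 ≤ r → r < 1 → ∀ n : ℕ,
      ∑ k ∈ Finset.range n, ((k : ℝ) + 1) ^ β * r ^ k ≤ c * (1 - r) ^ (-(1 + β)) := by
  obtain ⟨c, hc, h⟩ := exists_sum_rpow_sub_one_le (δ := 1 + β) (by linarith)
  obtain ⟨N, hN⟩ := exists_nat_ge β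
  refine ⟨c + N.factorial, by positivity, fun r hr hr1 n => ?_⟩
  have hs : 0 < 1 - r := by linarith
  set L : ℝ := (1 - r)⁻¹ with hL
  have hL0 : 0 < L := inv_pos.2 hs
  have hLβ : (1 - r) ^ (-(1 + β)) = L ^ (1 + β) := by
    rw [hL, Real.inv_rpow hs.le, Real.rpow_neg hs.le]
  rw [hLβ]
  have hterm : ∀ k : ℕ, ((k : ℝ) + 1) ^ β * r ^ k ≤
      (if k < ⌊L⌋₊ then ((k : ℝ) + 1) ^ β else 0) + L ^ (β - N) * (((k : ℝ) + 1) ^ N * r ^ k) := by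
    intro k
    have hp : (0 : ℝ) < (k : ℝ) + 1 := by positivity
    split_ifs with hk
    · have : ((k : ℝ) + 1) ^ β * r ^ k ≤ ((k : ℝ) + 1) ^ β * 1 := by
        gcongr
        exact pow_le_one₀ hr hr1.le
      have h2 : 0 ≤ L ^ (β - N) * (((k : ℝ) + 1) ^ N * r ^ k) := by positivity
      linarith
    · have hk' : L ≤ (k : ℝ) + 1 := by
        have h1 := Nat.lt_floor_add_one L
        have h2 : (⌊L⌋₊ : ℝ) ≤ k := by exact_mod_cast not_lt.1 hk
        linarith
      rw [zero_add, ← mul_assoc]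
      gcongr
      calc ((k : ℝ) + 1) ^ β = ((k : ℝ) + 1) ^ (β - N) * ((k : ℝ) + 1) ^ N := by
            rw [← Real.rpow_natCast, ← Real.rpow_add hp]; congr 1; ring
        _ ≤ _ := by
            gcongr ?_ * _
            exact Real.rpow_le_rpow_of_nonpos hL0 hk' (by linarith)
  have hsum1 : ∑ k ∈ Finset.range n, (if k < ⌊L⌋₊ then ((k : ℝ) + 1) ^ β else 0) ≤
      c * L ^ (1 + β) := by
    rw [← Finset.sum_filter]
    calc _ ≤ ∑ k ∈ Finset.range ⌊L⌋₊, ((k : ℝ) + 1) ^ β := by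
          refine Finset.sum_le_sum_of_subset_of_nonneg (fun k hk => ?_) fun _ _ _ => by positivity
          exact Finset.mem_range.2 (Finset.mem_filter.1 hk).2
      _ ≤ c * (⌊L⌋₊ : ℝ) ^ (1 + β) := by simpa using h ⌊L⌋₊
      _ ≤ _ := by
          gcongr
          · linarith
          · exact Nat.floor_le hL0.le
  have hsum2 : ∑ k ∈ Finset.range n, ((k : ℝ) + 1) ^ N * r ^ k ≤ N.factorial * L ^ (N + 1) := by
    have hsum := hasSum_choose_mul_geometric_of_norm_lt_one N
      (show ‖r‖ < 1 by rwa [Real.norm_of_nonneg hr])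
    have hle := sum_le_hasSum (Finset.range n) (fun k _ => by positivity) hsum
    calc _ ≤ ∑ k ∈ Finset.range n, N.factorial * (((k + N).choose N : ℝ) * r ^ k) := by
          refine Finset.sum_le_sum fun k _ => ?_
          rw [← mul_assoc]
          gcongr
          have := Nat.pow_succ_le_ascFactorial (k + 1) N
          rw [Nat.ascFactorial_eq_factorial_mul_choose] at this
          exact_mod_cast this
      _ ≤ _ := by
          rw [← Finset.mul_sum]
          gcongr
          simpa [hL] using hle
  calc _ ≤ _ := Finset.sum_le_sum fun k _ => hterm k
    _ ≤ c * L ^ (1 + β) + L ^ (β - N) * (N.factorial * L ^ (N + 1)) := by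
        rw [Finset.sum_add_distrib, ← Finset.mul_sum]
        gcongr
    _ = c * L ^ (1 + β) + N.factorial * (L ^ (β - N) * L ^ (N + 1)) := by ring
    _ = _ := by
        rw [← Real.rpow_natCast L (N + 1), ← Real.rpow_add hL0]
        have : β - N + ((N + 1 : ℕ) : ℝ) = 1 + β := by push_cast; ring
        rw [this]
        ring

theorem choose_add_le_succ_pow (k m : ℕ) : (k + m).choose m ≤ (k + 1) ^ m := by
  induction m with
  | zero => simp
  | succ m ih =>
    have h := Nat.add_one_mul_choose_eq (k + m) m
    refine Nat.le_of_mul_le_mul_right (c := m + 1) ?_ (Nat.succ_pos m)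
    rw [← add_assoc, ← h, pow_succ]
    calc (k + m + 1) * (k + m).choose m ≤ ((k + 1) * (m + 1)) * (k + 1) ^ m :=
          Nat.mul_le_mul (by nlinarith) ih
      _ = _ := by ring

/-! ### Admissibility implies the resolvent estimate -/

variable {X Y : Type*} [NormedAddCommGroup X] [NormedSpace ℂ X]
  [NormedAddCommGroup Y] [NormedSpace ℂ Y]

/-- The power series of `(1 - A)^{-(m+1)}`, under a decay condition on the powers of `A` in place of
`‖A‖ < 1`. -/
theorem tendsto_sum_choose_smul_pow {A R : X →L[ℂ] X} (hR : (1 - A) * R = 1) {c r : ℝ}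
    (hr : 0 ≤ r) (hr1 : r < 1) (hA : ∀ k : ℕ, ‖A ^ k‖ ≤ c * r ^ k) (m : ℕ) :
    Tendsto (fun n : ℕ => ∑ k ∈ Finset.range n, (k + m).choose m • A ^ k) atTop
      (𝓝 (R ^ (m + 1))) := by
  have hzero : ∀ j : ℕ, Tendsto (fun n : ℕ => (n + j).choose j • A ^ n) atTop (𝓝 0) := by
    intro j
    have hs := ((summable_choose_mul_geometric_of_norm_lt_one (R := ℝ) j
      (show ‖r‖ < 1 by rwa [Real.norm_of_nonneg hr])).tendsto_atTop_zero).const_mul c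
    rw [mul_zero] at hs
    refine squeeze_zero_norm (fun n => ?_) hs
    calc ‖(n + j).choose j • A ^ n‖ ≤ ((n + j).choose j : ℝ) * ‖A ^ n‖ := norm_nsmul_le
      _ ≤ ((n + j).choose j : ℝ) * (c * r ^ n) := by gcongr; exact hA n
      _ = _ := by ring
  induction m with
  | zero =>
    have h : ∀ n : ℕ, ∑ k ∈ Finset.range n, (k + 0).choose 0 • A ^ k = (1 - A ^ n) * R := by
      intro n
      have := geom_sum_mul_neg A n
      simp only [Nat.choose_zero_right, one_smul]
      rw [← this, mul_assoc, hR, mul_one]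
    simp_rw [h]
    have h0 : Tendsto (fun n : ℕ => A ^ n) atTop (𝓝 0) := by simpa using hzero 0
    simpa using (h0.const_sub 1).mul_const R
  | succ m ih =>
    have h : ∀ n : ℕ, (∑ k ∈ Finset.range n, (k + (m + 1)).choose (m + 1) • A ^ k) * (1 - A) =
        (∑ k ∈ Finset.range n, (k + m).choose m • A ^ k) - (n + m).choose (m + 1) • A ^ n := by
      intro n
      induction n with
      | zero => simp
      | succ n ihn =>
        rw [Finset.sum_range_succ, add_mul, ihn, Finset.sum_range_succ,
          show n + 1 + m = n + m + 1 by ring, show n + (m + 1) = n + m + 1 by ring,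
          Nat.choose_succ_succ, pow_succ, mul_sub, mul_one, smul_mul_assoc]
        simp only [add_smul]
        abel
    have h' : ∀ n : ℕ, ∑ k ∈ Finset.range n, (k + (m + 1)).choose (m + 1) • A ^ k =
        ((∑ k ∈ Finset.range n, (k + m).choose m • A ^ k) - (n + m).choose (m + 1) • A ^ n) * R := by
      intro n
      rw [← h n, mul_assoc, hR, mul_one]
    simp_rw [h']
    have h0 : Tendsto (fun n : ℕ => (n + m).choose (m + 1) • A ^ n) atTop (𝓝 0) := by
      refine squeeze_zero_norm (fun n => ?_) (tendsto_zero_iff_norm_tendsto_zero.1 (hzero (m + 1)))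
      rw [← Nat.cast_smul_eq_nsmul ℝ, ← Nat.cast_smul_eq_nsmul ℝ, norm_smul, norm_smul]
      gcongr
      simp only [Real.norm_natCast]
      exact_mod_cast Nat.choose_le_choose (m + 1) (by omega)
    simpa [pow_succ] using (ih.sub h0).mul_const R

theorem IsAdmissible.resolventEstimate [CompleteSpace X] {T : X →L[ℂ] X} {C : X →L[ℂ] Y}
    {α β : ℝ} (hT : IsPowerBounded T) (hβ : -1 < β) {m : ℕ} (hm : (m : ℝ) = (α + β) / 2)
    (h : IsAdmissible α T C) : ResolventEstimate β m T C := by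
  obtain ⟨M, hM, hadm⟩ := h
  obtain ⟨c, hc, hsum⟩ := exists_sum_rpow_mul_pow_le hβ
  refine ⟨Real.sqrt c * M, by positivity, fun ω hω => ?_⟩
  have hunit := isUnit_one_sub_smul hT hω
  obtain ⟨c₀, -, hc₀⟩ := hT
  have hω2 : ‖ω‖ ^ 2 < 1 := by nlinarith [norm_nonneg ω]
  have hs : 0 < 1 - ‖ω‖ ^ 2 := by linarith
  set s := 1 - ‖ω‖ ^ 2 with hsdef
  have hlim := tendsto_sum_choose_smul_pow (Ring.mul_inverse_cancel _ hunit) (norm_nonneg ω) hω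
    (c := c₀) (fun k => by
      rw [smul_pow, norm_smul, norm_pow, mul_comm]
      gcongr
      exact hc₀ k) m
  have hbound : ‖C ∘L (Ring.inverse (1 - ω • T) ^ (m + 1))‖ ≤
      Real.sqrt c * M * s ^ (-((1 + β) / 2)) := by
    refine ContinuousLinearMap.opNorm_le_bound _ (by positivity) fun x => ?_
    have hlimx : Tendsto (fun n : ℕ =>
        ‖C ((∑ k ∈ Finset.range n, (k + m).choose m • (ω • T) ^ k) x)‖) atTop
        (𝓝 ‖(C ∘L (Ring.inverse (1 - ω • T) ^ (m + 1))) x‖) :=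
      (((C.continuous.tendsto _).comp
        (((ContinuousLinearMap.apply ℂ X x).continuous.tendsto _).comp hlim))).norm
    refine le_of_tendsto hlimx (Eventually.of_forall fun n => ?_)
    have hstep : ‖C ((∑ k ∈ Finset.range n, (k + m).choose m • (ω • T) ^ k) x)‖ ≤
        ∑ k ∈ Finset.range n, ((k : ℝ) + 1) ^ m * ‖ω‖ ^ k * ‖C ((T ^ k) x)‖ := by
      rw [sum_apply, map_sum]
      refine (norm_sum_le _ _).trans (Finset.sum_le_sum fun k _ => ?_)
      rw [← Nat.cast_smul_eq_nsmul ℂ, smul_pow, smul_smul, smul_apply,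
        map_smul, norm_smul, norm_mul, norm_pow, Complex.norm_natCast]
      gcongr
      exact_mod_cast choose_add_le_succ_pow k m
    refine hstep.trans ?_
    refine (sq_le_sq₀ (by positivity) (by positivity)).1 ?_
    have hp : ∀ k : ℕ, (0 : ℝ) < (k : ℝ) + 1 := fun k => by positivity
    have hcs := Finset.sum_sq_le_sum_mul_sum_of_sq_le_mul (Finset.range n)
      (r := fun k => ((k : ℝ) + 1) ^ m * ‖ω‖ ^ k * ‖C ((T ^ k) x)‖)
      (f := fun k => ((k : ℝ) + 1) ^ β * (‖ω‖ ^ 2) ^ k)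
      (g := fun k => ((k : ℝ) + 1) ^ α * ‖C ((T ^ k) x)‖ ^ 2)
      (fun k _ => by positivity) (fun k _ => by positivity)
      (fun k _ => le_of_eq <| by
        have e : (((k : ℝ) + 1) ^ m) ^ 2 = ((k : ℝ) + 1) ^ β * ((k : ℝ) + 1) ^ α := by
          rw [← Real.rpow_natCast _ m, ← Real.rpow_mul_natCast (hp k).le, ← Real.rpow_add (hp k)]
          congr 1; push_cast; linarith
        rw [mul_pow, mul_pow, e]
        ring)
    refine hcs.trans ?_
    have hA : ∑ k ∈ Finset.range n, ((k : ℝ) + 1) ^ α * ‖C ((T ^ k) x)‖ ^ 2 ≤ M ^ 2 * ‖x‖ ^ 2 :=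
      ((hadm x).1.sum_le_tsum _ fun k _ => by positivity).trans (hadm x).2
    calc _ ≤ (c * s ^ (-(1 + β))) * (M ^ 2 * ‖x‖ ^ 2) :=
          mul_le_mul (hsum _ (by positivity) hω2 n) hA
            (Finset.sum_nonneg fun k _ => by positivity) (by positivity)
      _ = _ := by
          have e : (s ^ (-((1 + β) / 2))) ^ 2 = s ^ (-(1 + β)) := by
            rw [← Real.rpow_mul_natCast hs.le]; congr 1; push_cast; ring
          rw [mul_pow, mul_pow, mul_pow, e, Real.sq_sqrt hc]
          ring
  calc s ^ ((1 + β) / 2) * ‖C ∘L (Ring.inverse (1 - ω • T) ^ (m + 1))‖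
      ≤ s ^ ((1 + β) / 2) * (Real.sqrt c * M * s ^ (-((1 + β) / 2))) := by gcongr
    _ = Real.sqrt c * M * (s ^ ((1 + β) / 2) * s ^ (-((1 + β) / 2))) := by ring
    _ = _ := by rw [← Real.rpow_add hs]; simp

/-! ### The resolvent estimate implies admissibility -/

/-- The decay of `C T ^ k` at the multiples `k = (m + 1) n`, read off from the resolvent estimate at
the real points `ω = n / (n + 1)`. Here `(m + 1) n` leaves one factor `T ^ n` for each of the
`m + 1` factors `I - ω T`. -/
theorem exists_norm_comp_pow_mul_le [CompleteSpace X] {T : X →L[ℂ] X} {C : X →L[ℂ] Y} {β : ℝ}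
    (hT : IsRitt T) (hβ : -1 < β) {m : ℕ} (h : ResolventEstimate β m T C) :
    ∃ D : ℝ, 0 ≤ D ∧ ∀ n : ℕ,
      ‖C ∘L T ^ ((m + 1) * n)‖ ≤ D * ((n : ℝ) + 1) ^ ((1 + β) / 2 - (m + 1 : ℕ)) := by
  obtain ⟨K, hK, hres⟩ := h
  obtain ⟨hpb, c₁, hc₁, hritt⟩ := hT
  obtain ⟨c₀, hc₀, hpow⟩ := id hpb
  refine ⟨K * (c₀ + c₁) ^ (m + 1), by positivity, fun n => ?_⟩
  have hp : (0 : ℝ) < (n : ℝ) + 1 := by positivity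
  have hpC : (n : ℂ) + 1 ≠ 0 := by exact_mod_cast hp.ne'
  set ω : ℂ := ((n / (n + 1) : ℝ) : ℂ) with hω
  have hnorm : ‖ω‖ = n / (n + 1) := by
    rw [hω, Complex.norm_real, Real.norm_of_nonneg (by positivity)]
  have hlt : ‖ω‖ < 1 := by rw [hnorm, div_lt_one hp]; linarith
  have hunit := isUnit_one_sub_smul hpb hlt
  set R := Ring.inverse (1 - ω • T) with hR
  have hcomm : Commute (T ^ n) (1 - ω • T) :=
    (Commute.one_right _).sub_right (((Commute.refl T).pow_left n).smul_right ω)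
  have hRpow : R ^ (m + 1) * (1 - ω • T) ^ (m + 1) = 1 := by
    have h1 : R * (1 - ω • T) = 1 := Ring.inverse_mul_cancel _ hunit
    have h2 : (1 - ω • T) * R = 1 := Ring.mul_inverse_cancel _ hunit
    rw [← (show Commute R (1 - ω • T) from h1.trans h2.symm).mul_pow, h1, one_pow]
  have hfac : T ^ ((m + 1) * n) = R ^ (m + 1) * (T ^ n * (1 - ω • T)) ^ (m + 1) := by
    rw [hcomm.eq, hcomm.symm.mul_pow, ← mul_assoc, hRpow, one_mul, ← pow_mul, mul_comm n]
  have hsmall : ‖T ^ n * (1 - ω • T)‖ ≤ (c₀ + c₁) / (n + 1) := by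
    have e : T ^ n * (1 - ω • T) =
        (1 - ω) • T ^ n + (-ω) • (T ^ (n + 1) - T ^ n) := by
      rw [mul_sub, mul_one, mul_smul_comm, pow_succ, sub_smul, one_smul, smul_sub, neg_smul,
        neg_smul]
      abel
    have h1 : ‖(1 : ℂ) - ω‖ = 1 / (n + 1) := by
      have : (1 : ℂ) - ω = ((1 / (n + 1) : ℝ) : ℂ) := by
        rw [hω]; push_cast; field_simp; ring
      rw [this, Complex.norm_real, Real.norm_of_nonneg (by positivity)]
    have h2 : ‖T ^ (n + 1) - T ^ n‖ ≤ c₁ / (n + 1) := by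
      rw [le_div_iff₀ hp, mul_comm]
      simpa using hritt (n + 1) (by omega)
    rw [e]
    refine (norm_add_le _ _).trans ?_
    rw [norm_smul, norm_smul, h1, norm_neg]
    calc _ ≤ 1 / ((n : ℝ) + 1) * c₀ + 1 * (c₁ / (n + 1)) := by
          gcongr
          exact hpow n
      _ = _ := by ring
  have hCR : ‖C ∘L R ^ (m + 1)‖ ≤ K * ((n : ℝ) + 1) ^ ((1 + β) / 2) := by
    have h1 := hres ω hlt
    have h2 : (((n : ℝ) + 1) ^ ((1 + β) / 2))⁻¹ ≤ (1 - ‖ω‖ ^ 2) ^ ((1 + β) / 2) := by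
      rw [← Real.inv_rpow hp.le]
      refine Real.rpow_le_rpow (by positivity) ?_ (by linarith)
      have e : ((n : ℝ) + 1)⁻¹ = 1 - ‖ω‖ := by rw [hnorm]; field_simp; ring
      rw [e]
      nlinarith [norm_nonneg ω]
    have h3 := (mul_le_mul_of_nonneg_right h2 (norm_nonneg (C ∘L R ^ (m + 1)))).trans h1
    rwa [inv_mul_le_iff₀ (by positivity), mul_comm] at h3
  calc ‖C ∘L T ^ ((m + 1) * n)‖
      = ‖(C ∘L R ^ (m + 1)) ∘L (T ^ n * (1 - ω • T)) ^ (m + 1)‖ := by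
        rw [hfac]; rfl
    _ ≤ ‖C ∘L R ^ (m + 1)‖ * ‖(T ^ n * (1 - ω • T)) ^ (m + 1)‖ :=
        ContinuousLinearMap.opNorm_comp_le _ _
    _ ≤ (K * ((n : ℝ) + 1) ^ ((1 + β) / 2)) * ((c₀ + c₁) / (n + 1)) ^ (m + 1) := by
        gcongr
        exact (norm_pow_le' _ (Nat.succ_pos m)).trans (by gcongr)
    _ = _ := by
        rw [Real.rpow_sub hp, Real.rpow_natCast, div_pow]
        ring

/-- The sampled sequence `C T ^ {(p+1) l} x` is square summable with weight `(l + 1) ^ (2 δ - 1)` as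
soon as `‖C T ^ {p n}‖` is of order `(n + 1) ^ (-δ)`. -/
theorem exists_sum_sampled_le {T : X →L[ℂ] X} {C : X →L[ℂ] Y} (hT : IsPowerBounded T)
    (hSFE : SquareFunctionEstimate T) {δ D : ℝ} (hδ : 0 < δ) (hD : 0 ≤ D) {p : ℕ}
    (hC : ∀ n : ℕ, ‖C ∘L T ^ (p * n)‖ ≤ D * ((n : ℝ) + 1) ^ (-δ)) :
    ∃ B : ℝ, 0 ≤ B ∧ ∀ (x : X) (L : ℕ),
      ∑ l ∈ Finset.range L, ((l : ℝ) + 1) ^ (2 * δ - 1) * ‖C ((T ^ ((p + 1) * l)) x)‖ ^ 2 ≤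
        B * ‖x‖ ^ 2 := by
  obtain ⟨c₀, hc₀, hpow⟩ := hT
  obtain ⟨κ, hκ, hsq⟩ := hSFE
  obtain ⟨H, hH, hhardy⟩ := exists_hardy_le hδ
  set E : ℝ := D * ((p + 1) * c₀) with hE
  refine ⟨E ^ 2 * (H * κ ^ 2), by positivity, fun x L => ?_⟩
  set y : ℕ → ℝ := fun n => ‖(T ^ (n + 1)) x - (T ^ n) x‖ with hy
  set u : ℕ → Y := fun n => C ((T ^ ((p + 1) * n)) x) with hu
  -- `u n - u (n + 1) = C T ^ (p n) (1 + T + ⋯ + T ^ p) (T ^ n - T ^ (n + 1)) x`.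
  have hinc : ∀ n : ℕ, ‖u n - u (n + 1)‖ ≤ E * (((n : ℝ) + 1) ^ (-δ) * y n) := by
    intro n
    have hgeom : 1 - T ^ (p + 1) = (∑ i ∈ Finset.range (p + 1), T ^ i) * (1 - T) :=
      (geom_sum_mul_neg T (p + 1)).symm
    have e : u n - u (n + 1) =
        (C ∘L T ^ (p * n)) ((∑ i ∈ Finset.range (p + 1), T ^ i)
          ((T ^ n) x - (T ^ (n + 1)) x)) := by
      have h1 : T ^ ((p + 1) * n) - T ^ ((p + 1) * (n + 1)) =
          T ^ (p * n) * ((∑ i ∈ Finset.range (p + 1), T ^ i) * (T ^ n - T ^ (n + 1))) := by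
        have h2 : T ^ n - T ^ (n + 1) = (1 - T) * T ^ n := by
          rw [sub_mul, one_mul, pow_succ']
        rw [h2, ← mul_assoc (∑ i ∈ Finset.range (p + 1), T ^ i), ← hgeom, sub_mul, one_mul,
          mul_sub, ← pow_add, ← pow_add, ← pow_add]
        congr 2 <;> ring
      have h3 := congrArg (fun S : X →L[ℂ] X => C (S x)) h1
      simpa [hu] using h3
    have hS : ‖∑ i ∈ Finset.range (p + 1), T ^ i‖ ≤ (p + 1) * c₀ := by
      refine (norm_sum_le_of_le _ fun i _ => hpow i).trans ?_
      simp
    rw [e]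
    refine (ContinuousLinearMap.le_opNorm _ _).trans ?_
    calc _ ≤ (D * ((n : ℝ) + 1) ^ (-δ)) * (((p + 1) * c₀) * y n) := by
          gcongr
          · exact hC n
          · refine (ContinuousLinearMap.le_opNorm _ _).trans ?_
            rw [hy, norm_sub_rev]
            gcongr
      _ = _ := by rw [hE]; ring
  have htail : ∀ l N : ℕ, l ≤ N →
      ‖u l - u N‖ ≤ E * ∑ n ∈ Finset.Ico l N, ((n : ℝ) + 1) ^ (-δ) * y n := by
    intro l N hlN
    have e : u l - u N = ∑ n ∈ Finset.Ico l N, (u n - u (n + 1)) := by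
      have := Finset.sum_Ico_sub u hlN
      rw [← neg_sub (u N), ← this, ← Finset.sum_neg_distrib]
      simp
    rw [e, Finset.mul_sum]
    exact norm_sum_le_of_le _ fun n _ => hinc n
  -- The weights `(l + 1) ^ (2 δ - 1)` need not be summable, so the limit `N → ∞` is taken with
  -- `L` fixed.
  have hfin : ∀ N : ℕ, L ≤ N →
      ∑ l ∈ Finset.range L, ((l : ℝ) + 1) ^ (2 * δ - 1) * ‖u l - u N‖ ^ 2 ≤
        E ^ 2 * (H * κ ^ 2) * ‖x‖ ^ 2 := by
    intro N hLN
    calc _ ≤ ∑ l ∈ Finset.range N, ((l : ℝ) + 1) ^ (2 * δ - 1) * ‖u l - u N‖ ^ 2 :=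
          Finset.sum_le_sum_of_subset_of_nonneg (Finset.range_mono hLN)
            fun _ _ _ => by positivity
      _ ≤ ∑ l ∈ Finset.range N, E ^ 2 * (((l : ℝ) + 1) ^ (2 * δ - 1) *
            (∑ n ∈ Finset.Ico l N, ((n : ℝ) + 1) ^ (-δ) * y n) ^ 2) := by
          refine Finset.sum_le_sum fun l hl => ?_
          have := pow_le_pow_left₀ (norm_nonneg _) (htail l N (Finset.mem_range.1 hl).le) 2
          rw [mul_pow] at this
          refine (mul_le_mul_of_nonneg_left this (by positivity)).trans_eq ?_
          ring
      _ ≤ E ^ 2 * (H * (κ ^ 2 * ‖x‖ ^ 2)) := by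
          rw [← Finset.mul_sum]
          gcongr
          refine (hhardy y N).trans ?_
          gcongr
          exact ((hsq x).1.sum_le_tsum _ fun k _ => by positivity).trans (hsq x).2
      _ = _ := by ring
  have hu0 : Tendsto u atTop (𝓝 0) := by
    have hr : Tendsto (fun n : ℕ => ((n : ℝ) + 1) ^ (-δ)) atTop (𝓝 0) :=
      (tendsto_rpow_neg_atTop hδ).comp
        (tendsto_atTop_add_const_right _ 1 tendsto_natCast_atTop_atTop)
    have hr' : Tendsto (fun n : ℕ => D * ((n : ℝ) + 1) ^ (-δ) * (c₀ * ‖x‖)) atTop (𝓝 0) := by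
      simpa using (hr.const_mul D).mul_const (c₀ * ‖x‖)
    refine squeeze_zero_norm (fun n => ?_) hr'
    have e : u n = (C ∘L T ^ (p * n)) ((T ^ n) x) := by
      have : T ^ ((p + 1) * n) = T ^ (p * n) * T ^ n := by rw [← pow_add]; congr 1; ring
      exact congrArg (fun S : X →L[ℂ] X => C (S x)) this
    rw [e]
    refine (ContinuousLinearMap.le_opNorm _ _).trans ?_
    gcongr
    · exact hC n
    · exact (ContinuousLinearMap.le_opNorm _ _).trans (by gcongr; exact hpow n)
  have hlim : Tendsto
      (fun N => ∑ l ∈ Finset.range L, ((l : ℝ) + 1) ^ (2 * δ - 1) * ‖u l - u N‖ ^ 2) atTop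
      (𝓝 (∑ l ∈ Finset.range L, ((l : ℝ) + 1) ^ (2 * δ - 1) * ‖u l‖ ^ 2)) := by
    refine tendsto_finsetSum _ fun l _ => ?_
    simpa using ((hu0.const_sub (u l)).norm.pow 2).const_mul (((l : ℝ) + 1) ^ (2 * δ - 1))
  exact le_of_tendsto hlim (eventually_atTop.2 ⟨L, hfin⟩)

theorem sum_range_mul_eq_sum_sum {M : Type*} [AddCommMonoid M] (f : ℕ → M) (q L : ℕ) :
    ∑ k ∈ Finset.range (q * L), f k =
      ∑ s ∈ Finset.range q, ∑ l ∈ Finset.range L, f (q * l + s) := by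
  rw [Finset.sum_comm]
  induction L with
  | zero => simp
  | succ L ih => rw [Nat.mul_succ, Finset.sum_range_add, ih, Finset.sum_range_succ]

theorem rpow_mul_add_le {q s : ℕ} (hs : s < q) (l : ℕ) (α : ℝ) :
    (((q * l + s : ℕ) : ℝ) + 1) ^ α ≤ (q : ℝ) ^ |α| * ((l : ℝ) + 1) ^ α := by
  have hq : (1 : ℝ) ≤ q := by exact_mod_cast (Nat.zero_le s).trans_lt hs
  have hp : (0 : ℝ) < (l : ℝ) + 1 := by positivity
  rcases le_total 0 α with h | h
  · rw [abs_of_nonneg h, ← Real.mul_rpow (by positivity) hp.le]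
    refine Real.rpow_le_rpow (by positivity) ?_ h
    have : (s : ℝ) + 1 ≤ q := by exact_mod_cast hs
    push_cast
    linarith
  · calc (((q * l + s : ℕ) : ℝ) + 1) ^ α ≤ ((l : ℝ) + 1) ^ α := by
          refine Real.rpow_le_rpow_of_nonpos hp ?_ h
          have : (l : ℝ) ≤ q * l := le_mul_of_one_le_left (by positivity) hq
          push_cast
          linarith [Nat.cast_nonneg (α := ℝ) s]
      _ ≤ _ := le_mul_of_one_le_left (by positivity) (Real.one_le_rpow hq (abs_nonneg α))

theorem ResolventEstimate.isAdmissible [CompleteSpace X] {T : X →L[ℂ] X} {C : X →L[ℂ] Y}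
    {α β : ℝ} (hT : IsRitt T) (hSFE : SquareFunctionEstimate T) (hα : -1 < α) (hβ : -1 < β)
    {m : ℕ} (hm : (m : ℝ) = (α + β) / 2) (h : ResolventEstimate β m T C) :
    IsAdmissible α T C := by
  obtain ⟨D, hD, hdecay⟩ := exists_norm_comp_pow_mul_le hT hβ h
  set δ : ℝ := (1 + α) / 2 with hδdef
  have hδ : 0 < δ := by rw [hδdef]; linarith
  have hexp : (1 + β) / 2 - ((m + 1 : ℕ) : ℝ) = -δ := by push_cast; rw [hm, hδdef]; ring
  rw [hexp] at hdecay
  obtain ⟨B, hB, hsam⟩ := exists_sum_sampled_le hT.1 hSFE hδ hD hdecay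
  have hα' : 2 * δ - 1 = α := by rw [hδdef]; ring
  rw [hα'] at hsam
  obtain ⟨⟨c₀, hc₀, hpow⟩, -⟩ := hT
  set q : ℕ := m + 1 + 1 with hq
  set A : ℝ := q * ((q : ℝ) ^ |α| * (B * c₀ ^ 2)) with hA
  have hA0 : 0 ≤ A := by positivity
  have hnonneg : ∀ (x : X) (k : ℕ), 0 ≤ ((k : ℝ) + 1) ^ α * ‖C ((T ^ k) x)‖ ^ 2 :=
    fun x k => by positivity
  have hblock : ∀ (x : X) (s : ℕ), s < q → ∀ L : ℕ,
      ∑ l ∈ Finset.range L, (((q * l + s : ℕ) : ℝ) + 1) ^ α * ‖C ((T ^ (q * l + s)) x)‖ ^ 2 ≤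
        (q : ℝ) ^ |α| * (B * c₀ ^ 2) * ‖x‖ ^ 2 := by
    intro x s hs L
    calc _ ≤ ∑ l ∈ Finset.range L, (q : ℝ) ^ |α| *
            (((l : ℝ) + 1) ^ α * ‖C ((T ^ (q * l)) ((T ^ s) x))‖ ^ 2) := by
          refine Finset.sum_le_sum fun l _ => ?_
          rw [pow_add, mul_apply_eq_comp, ← mul_assoc]
          gcongr
          exact rpow_mul_add_le hs l α
      _ ≤ (q : ℝ) ^ |α| * (B * (c₀ * ‖x‖) ^ 2) := by
          rw [← Finset.mul_sum]
          gcongr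
          refine (hsam ((T ^ s) x) L).trans ?_
          gcongr
          exact (ContinuousLinearMap.le_opNorm _ _).trans (by gcongr; exact hpow s)
      _ = _ := by ring
  have hpart : ∀ (x : X) (n : ℕ),
      ∑ k ∈ Finset.range n, ((k : ℝ) + 1) ^ α * ‖C ((T ^ k) x)‖ ^ 2 ≤ A * ‖x‖ ^ 2 := by
    intro x n
    calc _ ≤ ∑ k ∈ Finset.range (q * n), ((k : ℝ) + 1) ^ α * ‖C ((T ^ k) x)‖ ^ 2 :=
          Finset.sum_le_sum_of_subset_of_nonneg
            (Finset.range_mono (Nat.le_mul_of_pos_left n (by omega))) fun k _ _ => hnonneg x k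
      _ ≤ ∑ s ∈ Finset.range q, (q : ℝ) ^ |α| * (B * c₀ ^ 2) * ‖x‖ ^ 2 := by
          rw [sum_range_mul_eq_sum_sum]
          exact Finset.sum_le_sum fun s hs => hblock x s (Finset.mem_range.1 hs) n
      _ = _ := by
          rw [Finset.sum_const, Finset.card_range, nsmul_eq_mul, hA]
          ring
  refine ⟨Real.sqrt A, Real.sqrt_nonneg A, fun x => ?_⟩
  rw [Real.sq_sqrt hA0]
  exact ⟨summable_of_sum_range_le (hnonneg x) (hpart x),
    Real.tsum_le_of_sum_range_le (hnonneg x) (hpart x)⟩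

end RittAdmissibility

theorem theorem3p1 {X Y : Type*}
    [NormedAddCommGroup X] [NormedSpace ℂ X] [CompleteSpace X]
    [NormedAddCommGroup Y] [NormedSpace ℂ Y] [CompleteSpace Y]
    (hX : RittAdmissibility.IsReflexiveSpace X)
    (T : X →L[ℂ] X) (hT : RittAdmissibility.IsRitt T)
    (hSFE : RittAdmissibility.SquareFunctionEstimate T)
    (α β : ℝ) (hα : -1 < α) (hβ : -1 < β) (hβ' : β < 3)
    (m : ℕ) (hm : (m : ℝ) = (α + β) / 2) (C : X →L[ℂ] Y) :
    RittAdmissibility.IsAdmissible α T C ↔ RittAdmissibility.ResolventEstimate β m T C :=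
  ⟨fun h => h.resolventEstimate hT.1 hβ hm, fun h => h.isAdmissible hT hSFE hα hβ hm⟩
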